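/- Let $B$ be a real separable Banach space with dual $B^*$, and let $\mu$ be a centered Gaussian measure on the Borel sets of $B$. For a probability measure $\nu$ on $B$ and $a\in B$ let $HD_{B^*}(a,\nu)=\inf_{t\in B^*}\nu(\{x\in B: t(x)\ge t(a)\})$ be the (Tukey) half space depth, and let $\Phi$ be the standard normal distribution function. Let $S:B^*\to B$, $Sf=\int_B x f(x)\,d\mu(x)$ (Bochner integral), and let $H_\mu$ be the Hilbert space obtained by completing the range of $S$ in the norm $\|\cdot\|_\mu$ given by the inner product $\langle Sf,Sg\rangle_\mu=\int_B fg\,d\mu$; it is viewed as a subset of $B$ through the (injective) continuous extension of the inclusion of the range of $S$ in $B$. Then: 1. if $\mu\neq\delta_0$, then $HD_{B^*}(a,\mu)=1-\Phi(\|a\|_\mu)$ for all $a\in H_\mu$; 2. $HD_{B^*}(a,\mu)=0$ for all $a\in B\setminus H_\mu$; 3. the set $\{a\in B: HD_{B^*}(a,\mu)=0\}$ is Borel, and its $\mu$-measure is $0$ if $H_\mu$ is finite dimensional and $1$ if $H_\mu$ is infinite dimensional; 4. suppose that $H_\mu$ is infinite dimensional, let $X_1,X_2,\dots$ be i.i.d.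 $B$-valued random vectors with law $\mu$ on a probability space $(\Omega,\mathcal F,P)$, and let $\mu_n=\frac1n\sum_{j=1}^n\delta_{X_j}$. Then for every $a\in H_\mu$, with $P$-probability one, $HD_{B^*}(a,\mu_n)=0$ for all $n\ge1$, whereas $HD_{B^*}(a,\mu)>0$; hence, with $P$-probability one, $HD_{B^*}(a,\mu_n)$ does not converge to $HD_{B^*}(a,\mu)$ as $n\to\infty$, i.e. consistency fails at every $a\in H_\mu$. -/

import Mathlib

open MeasureTheory ProbabilityTheory Filter Topology
open scoped ENNReal

noncomputable section

/-- The half space depth `inf_{t ∈ T} μ {x : t x ≥ t a}` of the point `a` with respect to a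
(non-empty) collection `T` of real functionals and a probability measure `μ`. -/
def halfSpaceDepth {B : Type*} [MeasurableSpace B] (T : Set (B → ℝ)) (a : B) (μ : Measure B) : ℝ :=
  ⨅ t : T, μ.real {x | (t : B → ℝ) a ≤ (t : B → ℝ) x}

/-- The topological dual `B*`, as a collection of real functionals on `B`. -/
def dualFunctionals (B : Type*) [NormedAddCommGroup B] [NormedSpace ℝ B] : Set (B → ℝ) :=
  Set.range fun f : StrongDual ℝ B => (f : B → ℝ)

/-- The Tukey half space depth `HD_{B*}(a, μ)`. -/
def tukeyDepth {B : Type*} [NormedAddCommGroup B] [NormedSpace ℝ B] [MeasurableSpace B]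
    (a : B) (μ : Measure B) : ℝ :=
  halfSpaceDepth (dualFunctionals B) a μ

/-- The empirical measure `(1 / n) ∑ δ_{X_j(ω)}` of the first `n` members of the sequence
`X 0, X 1, …` (a probability measure as soon as `n ≥ 1`). -/
def empiricalMeasure {Ω B : Type*} [MeasurableSpace B] (X : ℕ → Ω → B) (n : ℕ) (ω : Ω) :
    Measure B :=
  (n : ℝ≥0∞)⁻¹ • ∑ j ∈ Finset.range n, Measure.dirac (X j ω)

/-- The distribution function `Φ` of a centered Gaussian random variable with variance one. -/
def stdNormalCdf (x : ℝ) : ℝ := cdf (gaussianReal 0 1) x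

/-! ### The Hilbert space generating a Gaussian measure -/

namespace CameronMartin

variable {B : Type*} [NormedAddCommGroup B] [NormedSpace ℝ B] [CompleteSpace B]
  [SecondCountableTopology B] [MeasurableSpace B] [BorelSpace B]

theorem memLp_dual (μ : Measure B) [IsGaussian μ] (f : StrongDual ℝ B) :
    MemLp (fun x => f x) 2 μ :=
  IsGaussian.memLp_dual μ f 2 (by norm_num)

theorem integrable_smul (μ : Measure B) [IsGaussian μ] (f : StrongDual ℝ B) :
    Integrable (fun x => f x • x) μ :=
  memLp_one_iff_integrable.1
    (MemLp.smul (p := 2) (q := 2) (r := 1) (IsGaussian.memLp_two_id (μ := μ)) (memLp_dual μ f))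

theorem integrable_mul (μ : Measure B) [IsGaussian μ] (f g : StrongDual ℝ B) :
    Integrable (fun x => f x * g x) μ :=
  (memLp_dual μ f).integrable_mul (memLp_dual μ g)

/-- The linear map `S : B* → B`, `S f = ∫ x f(x) dμ(x)` (Bochner integral). -/
def S (μ : Measure B) [IsGaussian μ] : StrongDual ℝ B →ₗ[ℝ] B where
  toFun f := ∫ x, f x • x ∂μ
  map_add' f g := by
    simp only [FunLike.coe_add, Pi.add_apply, add_smul]
    exact integral_add (integrable_smul μ f) (integrable_smul μ g)
  map_smul' c f := by
    simp only [FunLike.coe_smul, Pi.smul_apply, smul_eq_mul, mul_smul, RingHom.id_apply]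
    exact integral_smul c _

theorem S_apply (μ : Measure B) [IsGaussian μ] (f : StrongDual ℝ B) :
    S μ f = ∫ x, f x • x ∂μ := rfl

theorem dual_S (μ : Measure B) [IsGaussian μ] (f g : StrongDual ℝ B) :
    g (S μ f) = ∫ x, f x * g x ∂μ := by
  rw [S_apply, ← g.integral_comp_comm (integrable_smul μ f)]
  simp

/-- The range of `S`, to be normed by `‖S f‖_μ = (∫ f² dμ)^{1/2}` and not by the norm of `B`. -/
def RangeS (μ : Measure B) [IsGaussian μ] : Type _ := LinearMap.range (S μ)

instance (μ : Measure B) [IsGaussian μ] : AddCommGroup (RangeS μ) :=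
  inferInstanceAs (AddCommGroup (LinearMap.range (S μ)))

instance (μ : Measure B) [IsGaussian μ] : Module ℝ (RangeS μ) :=
  inferInstanceAs (Module ℝ (LinearMap.range (S μ)))

/-- The element `S f` of the range of `S`. -/
def mk (μ : Measure B) [IsGaussian μ] : StrongDual ℝ B →ₗ[ℝ] RangeS μ := (S μ).rangeRestrict

/-- The inclusion of the range of `S` in `B`, as a linear map. -/
def inclLin (μ : Measure B) [IsGaussian μ] : RangeS μ →ₗ[ℝ] B := (LinearMap.range (S μ)).subtype

theorem inclLin_mk (μ : Measure B) [IsGaussian μ] (f : StrongDual ℝ B) :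
    inclLin μ (mk μ f) = S μ f := rfl

theorem mk_surjective (μ : Measure B) [IsGaussian μ] : Function.Surjective (mk μ) :=
  (S μ).surjective_rangeRestrict

/-- A functional `f` with `S f = x`. -/
def pre (μ : Measure B) [IsGaussian μ] (x : RangeS μ) : StrongDual ℝ B :=
  (mk_surjective μ x).choose

theorem mk_pre (μ : Measure B) [IsGaussian μ] (x : RangeS μ) : mk μ (pre μ x) = x :=
  (mk_surjective μ x).choose_spec

theorem integral_congr_S (μ : Measure B) [IsGaussian μ] {f f' g g' : StrongDual ℝ B}
    (hf : mk μ f = mk μ f') (hg : mk μ g = mk μ g') :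
    ∫ x, f x * g x ∂μ = ∫ x, f' x * g' x ∂μ := by
  have hf' : S μ f = S μ f' := congrArg (inclLin μ) hf
  have hg' : S μ g = S μ g' := congrArg (inclLin μ) hg
  rw [← dual_S, hf', dual_S]
  simp_rw [mul_comm (f' _)]
  rw [← dual_S, hg', dual_S]

/-- The inner product `⟨S f, S g⟩_μ = ∫ f g dμ` on the range of `S`; it does not depend on the
chosen `f` and `g`, see `inner_mk`. -/
instance core (μ : Measure B) [IsGaussian μ] : InnerProductSpace.Core ℝ (RangeS μ) where
  inner x y := ∫ z, pre μ x z * pre μ y z ∂μ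
  conj_inner_symm x y := by simp [mul_comm]
  re_inner_nonneg x := integral_nonneg fun z => mul_self_nonneg _
  add_left x y z := by
    rw [integral_congr_S μ (f' := pre μ x + pre μ y) (g' := pre μ z) (by simp [mk_pre]) rfl,
      ← integral_add (integrable_mul μ _ _) (integrable_mul μ _ _)]
    simp [add_mul]
  smul_left x y r := by
    rw [integral_congr_S μ (f' := r • pre μ x) (g' := pre μ y) (by simp [mk_pre]) rfl]
    simp [mul_assoc, integral_const_mul]
  definite x hx := by
    have h0 : (fun z => pre μ x z * pre μ x z) =ᵐ[μ] 0 :=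
      (integral_eq_zero_iff_of_nonneg (fun z => mul_self_nonneg _) (integrable_mul μ _ _)).1 hx
    have h1 : S μ (pre μ x) = 0 := by
      rw [S_apply]
      refine integral_eq_zero_of_ae ?_
      filter_upwards [h0] with z hz
      have : pre μ x z = 0 := mul_self_eq_zero.1 hz
      simp [this]
    rw [← mk_pre μ x]
    exact Subtype.ext h1

instance (μ : Measure B) [IsGaussian μ] : NormedAddCommGroup (RangeS μ) :=
  (core μ).toNormedAddCommGroup

instance (μ : Measure B) [IsGaussian μ] : InnerProductSpace ℝ (RangeS μ) :=
  InnerProductSpace.ofCore (core μ).toCore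

theorem inner_mk (μ : Measure B) [IsGaussian μ] (f g : StrongDual ℝ B) :
    inner ℝ (mk μ f) (mk μ g) = ∫ x, f x * g x ∂μ :=
  integral_congr_S μ (mk_pre μ _) (mk_pre μ _)

theorem norm_mk_sq (μ : Measure B) [IsGaussian μ] (f : StrongDual ℝ B) :
    ‖mk μ f‖ ^ 2 = ∫ x, f x ^ 2 ∂μ := by
  rw [← real_inner_self_eq_norm_sq, inner_mk]
  simp [sq]

theorem dual_inclLin (μ : Measure B) [IsGaussian μ] (f : StrongDual ℝ B) (x : RangeS μ) :
    f (inclLin μ x) = inner ℝ (mk μ f) x := by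
  rw [← mk_pre μ x, inclLin_mk, dual_S, inner_mk]
  simp [mul_comm]

theorem exists_bound (μ : Measure B) [IsGaussian μ] :
    ∃ C : ℝ, ∀ x : RangeS μ, ‖inclLin μ x‖ ≤ C * ‖x‖ := by
  have hint : Integrable (fun x : B => ‖x‖ ^ 2) μ :=
    (IsGaussian.memLp_two_id (μ := μ)).integrable_norm_pow (by norm_num)
  refine ⟨√(∫ x, ‖x‖ ^ 2 ∂μ), fun x => NormedSpace.norm_le_dual_bound ℝ _ (by positivity) ?_⟩
  intro f
  rw [dual_inclLin]
  have h1 : ‖mk μ f‖ ≤ ‖f‖ * √(∫ x, ‖x‖ ^ 2 ∂μ) := by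
    refine le_of_sq_le_sq ?_ (by positivity)
    rw [norm_mk_sq, mul_pow, Real.sq_sqrt (integral_nonneg fun x => by positivity),
      ← integral_const_mul]
    refine integral_mono_of_nonneg (.of_forall fun x => sq_nonneg _) (hint.const_mul _)
      (.of_forall fun x => ?_)
    have := f.le_opNorm x
    simp only
    rw [← mul_pow, ← sq_abs]
    gcongr
    exact this
  calc ‖inner ℝ (mk μ f) x‖ ≤ ‖mk μ f‖ * ‖x‖ := norm_inner_le_norm _ _
    _ ≤ (‖f‖ * √(∫ x, ‖x‖ ^ 2 ∂μ)) * ‖x‖ := by gcongr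
    _ = _ := by ring

/-- The inclusion of the range of `S` in `B` is continuous for `‖·‖_μ`. -/
def incl (μ : Measure B) [IsGaussian μ] : RangeS μ →L[ℝ] B :=
  (inclLin μ).mkContinuousOfExistsBound (exists_bound μ)

end CameronMartin

/-- The Hilbert space `H_μ` generating the centered Gaussian measure `μ`: the completion of the
range of `S` for the inner product `⟨S f, S g⟩_μ = ∫ f g dμ`. Its norm is `‖·‖_μ`. -/
abbrev CameronMartinSpace {B : Type*} [NormedAddCommGroup B] [NormedSpace ℝ B] [CompleteSpace B]
    [SecondCountableTopology B] [MeasurableSpace B] [BorelSpace B]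
    (μ : Measure B) [IsGaussian μ] : Type _ :=
  UniformSpace.Completion (CameronMartin.RangeS μ)

namespace CameronMartinSpace

variable {B : Type*} [NormedAddCommGroup B] [NormedSpace ℝ B] [CompleteSpace B]
  [SecondCountableTopology B] [MeasurableSpace B] [BorelSpace B]

/-- The continuous extension `H_μ → B` of the inclusion of the range of `S`. It is injective, and
`H_μ` is viewed as a subset of `B` through it. -/
def toBanach (μ : Measure B) [IsGaussian μ] : CameronMartinSpace μ →L[ℝ] B :=
  (CameronMartin.incl μ).extend UniformSpace.Completion.toComplL

theorem toBanach_coe (μ : Measure B) [IsGaussian μ] (x : CameronMartin.RangeS μ) :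
    toBanach μ (x : CameronMartinSpace μ) = CameronMartin.inclLin μ x :=
  ContinuousLinearMap.extend_eq (e := UniformSpace.Completion.toComplL (𝕜 := ℝ))
    (CameronMartin.incl μ) UniformSpace.Completion.denseRange_coe
    (UniformSpace.Completion.isUniformInducing_coe _) x

theorem dual_toBanach (μ : Measure B) [IsGaussian μ] (f : StrongDual ℝ B)
    (h : CameronMartinSpace μ) :
    f (toBanach μ h) = inner ℝ (CameronMartin.mk μ f : CameronMartinSpace μ) h := by
  induction h using UniformSpace.Completion.induction_on with
  | hp => exact isClosed_eq (by fun_prop) (by fun_prop)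
  | ih x => rw [toBanach_coe, CameronMartin.dual_inclLin, UniformSpace.Completion.inner_coe]

theorem toBanach_injective (μ : Measure B) [IsGaussian μ] :
    Function.Injective (toBanach μ) := by
  rw [injective_iff_map_eq_zero]
  intro h hh
  have hd := UniformSpace.Completion.denseRange_coe (α := CameronMartin.RangeS μ)
  refine hd.eq_zero_of_inner_right ℝ fun x => ?_
  obtain ⟨f, rfl⟩ := CameronMartin.mk_surjective μ x
  rw [← dual_toBanach, hh, map_zero]

end CameronMartinSpace

end

/-! ### The standard normal distribution function -/

/-! Under `μ` a functional `f` is centered normal with standard deviation `‖mk μ f‖`, so when this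
is nonzero the half space at `a` has mass `1 - Φ(f a / ‖mk μ f‖)` (`measureReal_halfspace`), and the
depth is governed by the supremum of these quotients. By the Riesz representation theorem the
quotients are bounded, and null functionals vanish at `a`, exactly when `a` comes from some `h` in
`H_μ` (`mem_range_toBanach_of_bound`). Cauchy-Schwarz and density of the range of `S` then make the
supremum `‖h‖`. Off `H_μ` the half spaces have arbitrarily small mass. Hence depth zero
characterizes the complement of `H_μ`.

In infinite dimension, boundedness of evaluation would force infinitely many independent standard
normal variables into one interval, an event of probability zero. In finite dimension, boundedness
only requires null functionals to vanish at `a`, which holds almost surely.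

For the empirical depth, infinite dimension makes every finite-dimensional subspace `μ`-null. Almost
surely no sample point lies in the span of `b` and the others, so `b` is outside the convex hull of
the sample and a separating half space contains no sample point. -/

instance nullSingletonClass_gaussianReal_zero_one : NullSingletonClass (gaussianReal 0 1) :=
  nullSingletonClass_gaussianReal one_ne_zero

theorem gaussianReal_real_Ici (x : ℝ) :
    (gaussianReal 0 1).real (Set.Ici x) = 1 - stdNormalCdf x := by
  rw [stdNormalCdf, cdf_eq_real, ← probReal_compl_eq_one_sub measurableSet_Iic, Set.compl_Iic]
  exact measureReal_congr Ioi_ae_eq_Ici.symm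

theorem stdNormalCdf_lt_one (x : ℝ) : stdNormalCdf x < 1 := by
  rw [← sub_pos, ← gaussianReal_real_Ici]
  refine measureReal_nonneg.lt_of_ne' fun h => ?_
  have := gaussianReal_absolutelyContinuous' 0 one_ne_zero ((measureReal_eq_zero_iff).1 h)
  simp at this

theorem stdNormalCdf_nonneg (x : ℝ) : 0 ≤ stdNormalCdf x := cdf_nonneg _ _

theorem stdNormalCdf_mono : Monotone stdNormalCdf := monotone_cdf _

theorem tendsto_stdNormalCdf_atTop : Tendsto stdNormalCdf atTop (𝓝 1) := tendsto_cdf_atTop _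

theorem continuous_stdNormalCdf : Continuous stdNormalCdf := by
  refine continuous_iff_continuousAt.2 fun x => ?_
  refine continuousAt_iff_continuous_left'_right'.2 ⟨?_, ?_⟩
  · rw [stdNormalCdf_mono.continuousWithinAt_Iio_iff_leftLim_eq]
    have h := (cdf (gaussianReal 0 1)).measure_singleton x
    rw [measure_cdf, measure_singleton, eq_comm, ENNReal.ofReal_eq_zero, sub_nonpos] at h
    exact le_antisymm (stdNormalCdf_mono.leftLim_le le_rfl) h
  · exact ((cdf (gaussianReal 0 1)).right_continuous x).mono Set.Ioi_subset_Ici_self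

/-! ### Elementary properties of the depth -/

section Depth

variable {B : Type*} [NormedAddCommGroup B] [NormedSpace ℝ B] [MeasurableSpace B]

theorem tukeyDepth_le (f : StrongDual ℝ B) (a : B) (μ : Measure B) :
    tukeyDepth a μ ≤ μ.real {x | f a ≤ f x} :=
  ciInf_le (f := fun t : dualFunctionals B => μ.real {x | (t : B → ℝ) a ≤ (t : B → ℝ) x})
    ⟨0, by rintro _ ⟨t, rfl⟩; exact measureReal_nonneg⟩ ⟨f, f, rfl⟩

theorem le_tukeyDepth {c : ℝ} {a : B} {μ : Measure B}
    (h : ∀ f : StrongDual ℝ B, c ≤ μ.real {x | f a ≤ f x}) : c ≤ tukeyDepth a μ := by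
  have : Nonempty (dualFunctionals B) := ⟨⟨_, 0, rfl⟩⟩
  refine le_ciInf ?_
  rintro ⟨_, f, rfl⟩
  exact h f

theorem tukeyDepth_nonneg (a : B) (μ : Measure B) : 0 ≤ tukeyDepth a μ :=
  le_tukeyDepth fun _ => measureReal_nonneg

end Depth

namespace CameronMartin

variable {B : Type*} [NormedAddCommGroup B] [NormedSpace ℝ B] [CompleteSpace B]
  [SecondCountableTopology B] [MeasurableSpace B] [BorelSpace B]
  {μ : Measure B} [IsGaussian μ]

/-! ### One-dimensional marginals -/

theorem ae_eq_zero_of_mk_eq_zero {f : StrongDual ℝ B} (hf : mk μ f = 0) : ∀ᵐ x ∂μ, f x = 0 := by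
  have h := norm_mk_sq μ f
  rw [hf, norm_zero, zero_pow two_ne_zero, eq_comm,
    integral_eq_zero_iff_of_nonneg (fun x => sq_nonneg _) (memLp_dual μ f).integrable_sq] at h
  filter_upwards [h] with x hx
  simpa using hx

theorem integral_dual_eq_zero (hμ : ∫ x, x ∂μ = 0) (f : StrongDual ℝ B) : ∫ x, f x ∂μ = 0 := by
  rw [f.integral_comp_comm (φ := fun x => x) IsGaussian.integrable_id, hμ, map_zero]

theorem map_dual_of_norm_eq_one (hμ : ∫ x, x ∂μ = 0) {f : StrongDual ℝ B} (hf : ‖mk μ f‖ = 1) :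
    μ.map f = gaussianReal 0 1 := by
  rw [IsGaussian.map_eq_gaussianReal f, integral_dual_eq_zero hμ,
    variance_eq_integral (by fun_prop), integral_dual_eq_zero hμ]
  simp only [sub_zero]
  rw [← norm_mk_sq, hf]
  simp

theorem measureReal_halfspace (hμ : ∫ x, x ∂μ = 0) {f : StrongDual ℝ B} (hf : mk μ f ≠ 0)
    (c : ℝ) : μ.real {x | c ≤ f x} = 1 - stdNormalCdf (c / ‖mk μ f‖) := by
  have hpos : 0 < ‖mk μ f‖ := norm_pos_iff.2 hf
  have h1 : ‖mk μ (‖mk μ f‖⁻¹ • f)‖ = 1 := by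
    rw [map_smul, norm_smul, norm_inv, norm_norm, inv_mul_cancel₀ hpos.ne']
  rw [← gaussianReal_real_Ici, ← map_dual_of_norm_eq_one hμ h1,
    map_measureReal_apply (by fun_prop) measurableSet_Ici]
  congr 1
  ext x
  simp [div_eq_inv_mul, hpos]

theorem measure_dual_eq_zero (hμ : ∫ x, x ∂μ = 0) {f : StrongDual ℝ B} (hf : mk μ f ≠ 0) :
    μ {x | f x = 0} = 0 := by
  have hpos : 0 < ‖mk μ f‖ := norm_pos_iff.2 hf
  have h1 : ‖mk μ (‖mk μ f‖⁻¹ • f)‖ = 1 := by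
    rw [map_smul, norm_smul, norm_inv, norm_norm, inv_mul_cancel₀ hpos.ne']
  have h2 : (gaussianReal 0 1) {0} = 0 := measure_singleton 0
  rw [← map_dual_of_norm_eq_one hμ h1, Measure.map_apply (by fun_prop)
    (measurableSet_singleton _)] at h2
  rw [← h2]
  congr 1
  ext x
  simp [hpos.ne']

/-! ### The range of the embedding of the Hilbert space -/

open CameronMartinSpace

theorem norm_dual_toBanach_le (f : StrongDual ℝ B) (h : CameronMartinSpace μ) :
    |f (toBanach μ h)| ≤ ‖h‖ * ‖mk μ f‖ := by
  rw [dual_toBanach, mul_comm]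
  simpa using abs_real_inner_le_norm (mk μ f : CameronMartinSpace μ) h

/-- Evaluation at `a` descends to a linear form on the range of `S`. -/
theorem exists_evalLin {a : B} (ha : ∀ f : StrongDual ℝ B, mk μ f = 0 → f a = 0) :
    ∃ φ : RangeS μ →ₗ[ℝ] ℝ, ∀ f, φ (mk μ f) = f a := by
  have key : ∀ f g : StrongDual ℝ B, mk μ f = mk μ g → f a = g a := fun f g hfg => by
    have := ha (f - g) (by rw [map_sub, hfg, sub_self])
    simpa [sub_eq_zero] using this
  refine ⟨{ toFun := fun x => pre μ x a, map_add' := fun x y => ?_, map_smul' := fun c x => ?_ },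
    fun f => key _ _ (mk_pre μ _)⟩
  · exact key _ (pre μ x + pre μ y) (by simp [mk_pre])
  · exact key _ (c • pre μ x) (by simp [mk_pre])

/-- Evaluation at `a` extends to a bounded form on the completion, its Riesz representative maps to
a vector on which every functional agrees with `a`, and functionals separate points. -/
theorem mem_range_toBanach_of_bound {a : B} {C : ℝ}
    (ha : ∀ f : StrongDual ℝ B, |f a| ≤ C * ‖mk μ f‖) : a ∈ Set.range (toBanach μ) := by
  obtain ⟨φ, hφ⟩ := exists_evalLin (μ := μ) (a := a) fun f hf => by simpa [hf] using ha f
  let ψ : StrongDual ℝ (RangeS μ) := φ.mkContinuous C fun x => by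
    obtain ⟨f, rfl⟩ := mk_surjective μ x
    rw [hφ]
    exact ha f
  let Ψ : StrongDual ℝ (CameronMartinSpace μ) := ψ.extend UniformSpace.Completion.toComplL
  have hΨ : ∀ f, Ψ (mk μ f : CameronMartinSpace μ) = f a := fun f =>
    (ContinuousLinearMap.extend_eq (e := UniformSpace.Completion.toComplL (𝕜 := ℝ))
      ψ UniformSpace.Completion.denseRange_coe
      (UniformSpace.Completion.isUniformInducing_coe _) _).trans (hφ f)
  refine ⟨(InnerProductSpace.toDual ℝ _).symm Ψ, ?_⟩
  refine (SeparatingDual.eq_iff_forall_dual_eq (R := ℝ)).2 fun f => ?_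
  rw [dual_toBanach, real_inner_comm, InnerProductSpace.toDual_symm_apply, hΨ]

/-- This exhibits the range as a countable union of closed sets, which gives measurability and
reduces nullity to one bound at a time. -/
theorem range_toBanach_eq : Set.range (toBanach μ) =
    ⋃ n : ℕ, {a : B | ∀ f : StrongDual ℝ B, |f a| ≤ n * ‖mk μ f‖} := by
  ext a
  simp only [Set.mem_iUnion, Set.mem_ofPred_eq]
  constructor
  · rintro ⟨h, rfl⟩
    obtain ⟨n, hn⟩ := exists_nat_ge ‖h‖
    exact ⟨n, fun f => (norm_dual_toBanach_le f h).trans (by gcongr)⟩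
  · rintro ⟨n, hn⟩
    exact mem_range_toBanach_of_bound hn

theorem measurableSet_range_toBanach : MeasurableSet (Set.range (toBanach μ)) := by
  rw [range_toBanach_eq]
  refine .iUnion fun n => IsClosed.measurableSet ?_
  simp only [Set.ofPred_forall]
  exact isClosed_iInter fun f => isClosed_le (by fun_prop) (by fun_prop)

theorem finiteDimensional_rangeS [FiniteDimensional ℝ (CameronMartinSpace μ)] :
    FiniteDimensional ℝ (RangeS μ) :=
  FiniteDimensional.of_injective
    (UniformSpace.Completion.toComplₗᵢ (𝕜 := ℝ) (E := RangeS μ)).toLinearMap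
    (UniformSpace.Completion.toComplₗᵢ (𝕜 := ℝ) (E := RangeS μ)).injective

theorem finiteDimensional_of_rangeS [FiniteDimensional ℝ (RangeS μ)] :
    FiniteDimensional ℝ (CameronMartinSpace μ) := by
  let e : RangeS μ →L[ℝ] CameronMartinSpace μ := UniformSpace.Completion.toComplL
  have hclosed : IsClosed (LinearMap.range e.toLinearMap : Set (CameronMartinSpace μ)) :=
    Submodule.closed_of_finiteDimensional _
  refine FiniteDimensional.of_surjective e.toLinearMap (Set.range_eq_univ.1 ?_)
  have hd : DenseRange e := UniformSpace.Completion.denseRange_coe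
  rw [← hd.closure_range]
  exact hclosed.closure_eq.symm

theorem ae_mem_range_toBanach [FiniteDimensional ℝ (CameronMartinSpace μ)] :
    ∀ᵐ a ∂μ, a ∈ Set.range (toBanach μ) := by
  have := finiteDimensional_rangeS (μ := μ)
  -- There may be uncountably many null functionals; the Lindelöf property reduces them to countably
  -- many.
  obtain ⟨T, hT, hTU⟩ := TopologicalSpace.isOpen_biUnion_countable
    {f : StrongDual ℝ B | mk μ f = 0} (fun f => {a | f a ≠ 0})
    (fun f _ => isOpen_ne_fun (by fun_prop) (by fun_prop))
  have hnull : ∀ᵐ a ∂μ, ∀ f ∈ T, f a = 0 :=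
    (ae_ball_iff hTU.1).2 fun f hf => ae_eq_zero_of_mk_eq_zero (hT hf)
  filter_upwards [hnull] with a ha
  have ha' : ∀ f : StrongDual ℝ B, mk μ f = 0 → f a = 0 := by
    intro f hf
    by_contra hne
    have : a ∈ ⋃ f ∈ {f : StrongDual ℝ B | mk μ f = 0}, {a | f a ≠ 0} :=
      Set.mem_biUnion (x := f) hf hne
    rw [← hTU.2] at this
    simp only [Set.mem_iUnion] at this
    obtain ⟨g, hg, hga⟩ := this
    exact hga (ha g hg)
  obtain ⟨φ, hφ⟩ := exists_evalLin ha'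
  refine mem_range_toBanach_of_bound (C := ‖LinearMap.toContinuousLinearMap φ‖) fun f => ?_
  rw [← hφ]
  exact (LinearMap.toContinuousLinearMap φ).le_opNorm _

theorem exists_orthonormal (hinf : ¬ FiniteDimensional ℝ (CameronMartinSpace μ)) :
    ∃ f : ℕ → StrongDual ℝ B, Orthonormal ℝ fun n => mk μ (f n) := by
  have hinf' : ¬ FiniteDimensional ℝ (RangeS μ) := fun h => hinf finiteDimensional_of_rangeS
  let b := Module.Basis.ofVectorSpace ℝ (RangeS μ)
  have : Infinite (Module.Basis.ofVectorSpaceIndex ℝ (RangeS μ)) := by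
    by_contra h
    rw [not_infinite_iff_finite] at h
    exact hinf' (Module.Finite.of_basis b)
  have hli : LinearIndependent ℝ fun n : ℕ => b (Infinite.natEmbedding _ n) :=
    b.linearIndependent.comp _ (Infinite.natEmbedding _).injective
  -- Gram-Schmidt is run in the range of `S`, not in its completion, so that each vector is
  -- represented by a functional.
  refine ⟨fun n => pre μ (InnerProductSpace.gramSchmidtNormed ℝ
    (fun n : ℕ => b (Infinite.natEmbedding _ n)) n), ?_⟩
  simp only [mk_pre]
  exact InnerProductSpace.gramSchmidtNormed_orthonormal hli

/-- The functionals are jointly Gaussian, and orthogonality says that they are uncorrelated. -/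
theorem iIndepFun_of_orthonormal (hμ : ∫ x, x ∂μ = 0) {n : ℕ} {f : Fin n → StrongDual ℝ B}
    (hf : Orthonormal ℝ fun i => mk μ (f i)) : iIndepFun (fun i x => f i x) μ := by
  refine HasGaussianLaw.iIndepFun_of_covariance_eq_zero ?_ fun i j hij => ?_
  · exact (IsGaussian.hasGaussianLaw_id (μ := μ)).map_fun (ContinuousLinearMap.pi f)
  · rw [covariance_eq_sub (memLp_dual μ _) (memLp_dual μ _), integral_dual_eq_zero hμ]
    have : inner ℝ (mk μ (f i)) (mk μ (f j)) = 0 := hf.2 hij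
    rw [inner_mk] at this
    simpa using this

theorem measure_range_toBanach_eq_zero (hμ : ∫ x, x ∂μ = 0)
    (hinf : ¬ FiniteDimensional ℝ (CameronMartinSpace μ)) : μ (Set.range (toBanach μ)) = 0 := by
  rw [range_toBanach_eq, measure_iUnion_null_iff]
  intro c
  obtain ⟨f, hf⟩ := exists_orthonormal hinf
  set p := gaussianReal 0 1 (Set.Icc (-(c : ℝ)) c) with hp
  have hp1 : p < 1 := by
    refine (measure_mono Set.Icc_subset_Iic_self).trans_lt ?_
    rw [← ofReal_cdf, ← ENNReal.ofReal_one, ENNReal.ofReal_lt_ofReal_iff one_pos]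
    exact stdNormalCdf_lt_one c
  refine le_antisymm (ge_of_tendsto' (ENNReal.tendsto_pow_atTop_nhds_zero_of_lt_one hp1)
    fun n => ?_) bot_le
  have hind := iIndepFun_of_orthonormal hμ (hf.comp (fun i : Fin n => (i : ℕ)) Fin.val_injective)
  calc μ {a : B | ∀ f : StrongDual ℝ B, |f a| ≤ c * ‖mk μ f‖}
      ≤ μ (⋂ i ∈ (Finset.univ : Finset (Fin n)), (fun x => f i x) ⁻¹' Set.Icc (-(c : ℝ)) c) := by
        refine measure_mono fun a ha => ?_
        simp only [Set.mem_iInter, Set.mem_preimage, Set.mem_Icc, ← abs_le]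
        intro i _
        simpa [hf.1 i] using ha (f i)
    _ = ∏ i : Fin n, μ ((fun x => f i x) ⁻¹' Set.Icc (-(c : ℝ)) c) :=
        hind.measure_inter_preimage_eq_mul _ fun i _ => measurableSet_Icc
    _ = p ^ n := by
        rw [Finset.prod_eq_pow_card (b := p), Finset.card_univ, Fintype.card_fin]
        intro i _
        rw [hp, ← map_dual_of_norm_eq_one hμ (hf.1 i),
          Measure.map_apply (by fun_prop) measurableSet_Icc]

end CameronMartin

namespace CameronMartin

variable {B : Type*} [NormedAddCommGroup B] [NormedSpace ℝ B] [CompleteSpace B]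
  [SecondCountableTopology B] [MeasurableSpace B] [BorelSpace B]
  {μ : Measure B} [IsGaussian μ]

open CameronMartinSpace

/-! ### The depth with respect to a centered Gaussian measure -/

theorem le_tukeyDepth_toBanach (hμ : ∫ x, x ∂μ = 0) (h : CameronMartinSpace μ) :
    1 - stdNormalCdf ‖h‖ ≤ tukeyDepth (toBanach μ h) μ := by
  refine le_tukeyDepth fun f => ?_
  by_cases hf : mk μ f = 0
  · have hfa : f (toBanach μ h) = 0 := by simpa [hf] using norm_dual_toBanach_le f h
    have hone : μ.real {x | f (toBanach μ h) ≤ f x} = 1 := by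
      rw [← probReal_univ (μ := μ)]
      refine measureReal_congr ?_
      filter_upwards [ae_eq_zero_of_mk_eq_zero hf] with x hx
      exact propext (iff_of_true (hfa.trans hx.symm).le trivial)
    rw [hone]
    linarith [stdNormalCdf_nonneg ‖h‖]
  · rw [measureReal_halfspace hμ hf]
    refine sub_le_sub_left (stdNormalCdf_mono ?_) _
    rw [div_le_iff₀ (norm_pos_iff.2 hf)]
    exact (le_abs_self _).trans (norm_dual_toBanach_le f h)

theorem tukeyDepth_toBanach_pos (hμ : ∫ x, x ∂μ = 0) (h : CameronMartinSpace μ) :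
    0 < tukeyDepth (toBanach μ h) μ :=
  (sub_pos.2 (stdNormalCdf_lt_one _)).trans_le (le_tukeyDepth_toBanach hμ h)

theorem eq_dirac_of_mk_eq_zero (h0 : ∀ f : StrongDual ℝ B, mk μ f = 0) :
    μ = Measure.dirac 0 := by
  refine Measure.ext_of_charFunDual ?_
  ext f
  have : (fun x => Complex.exp (f x * Complex.I)) =ᵐ[μ] fun _ => 1 := by
    filter_upwards [ae_eq_zero_of_mk_eq_zero (h0 f)] with x hx
    simp [hx]
  rw [charFunDual_apply, integral_congr_ae this, charFunDual_apply]
  simp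

/-- The optimal direction `h` itself need not lie in the range of `S`; it is approximated by
elements that do, using continuity of the half-space mass in the direction. -/
theorem tukeyDepth_toBanach_le (hμ : ∫ x, x ∂μ = 0) (hd : μ ≠ Measure.dirac 0)
    (h : CameronMartinSpace μ) : tukeyDepth (toBanach μ h) μ ≤ 1 - stdNormalCdf ‖h‖ := by
  -- The quotient has no continuous value at direction zero; here any non-null functional gives mass
  -- `1 - Φ(0)`, and one exists because `μ` is not the point mass.
  rcases eq_or_ne h 0 with rfl | hh
  · obtain ⟨f, hf⟩ : ∃ f : StrongDual ℝ B, mk μ f ≠ 0 := by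
      by_contra! h0
      exact hd (eq_dirac_of_mk_eq_zero h0)
    refine (tukeyDepth_le f _ μ).trans ?_
    rw [measureReal_halfspace hμ hf]
    simp
  have hpos : 0 < ‖h‖ := norm_pos_iff.2 hh
  have hcont : ContinuousAt
      (fun y : CameronMartinSpace μ => 1 - stdNormalCdf (inner ℝ y h / ‖y‖)) h :=
    continuousAt_const.sub (continuous_stdNormalCdf.continuousAt.comp
      ((by fun_prop : ContinuousAt (fun y : CameronMartinSpace μ => inner ℝ y h) h).div
        (by fun_prop) hpos.ne'))
  have hval : inner ℝ h h / ‖h‖ = ‖h‖ := by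
    rw [real_inner_self_eq_norm_sq, sq, mul_div_cancel_right₀ _ hpos.ne']
  refine le_of_forall_gt fun c hc => ?_
  rw [← hval] at hc
  have hev : ∀ᶠ y in 𝓝 h, 1 - stdNormalCdf (inner ℝ y h / ‖y‖) < c ∧ y ≠ 0 :=
    (hcont.eventually_lt_const hc).and (isOpen_ne.mem_nhds hh)
  have hdense : DenseRange ((↑) : RangeS μ → CameronMartinSpace μ) :=
    UniformSpace.Completion.denseRange_coe
  obtain ⟨x, hxc, hx0⟩ := hdense.mem_nhds hev
  obtain ⟨f, rfl⟩ := mk_surjective μ x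
  have hf : mk μ f ≠ 0 := fun h0 => hx0 (by rw [h0]; rfl)
  refine (tukeyDepth_le f _ μ).trans_lt ?_
  rw [measureReal_halfspace hμ hf, dual_toBanach]
  simpa using hxc

theorem tukeyDepth_eq_zero_of_notMem_range (hμ : ∫ x, x ∂μ = 0) {a : B}
    (ha : a ∉ Set.range (toBanach μ)) : tukeyDepth a μ = 0 := by
  refine le_antisymm ?_ (tukeyDepth_nonneg a μ)
  have hbound : ∀ n : ℕ, tukeyDepth a μ ≤ 1 - stdNormalCdf n := by
    intro n
    obtain ⟨f, hf⟩ : ∃ f : StrongDual ℝ B, n * ‖mk μ f‖ < f a := by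
      by_contra! hle
      refine ha (mem_range_toBanach_of_bound (C := n) fun f => abs_le'.2 ⟨hle f, ?_⟩)
      simpa using hle (-f)
    refine (tukeyDepth_le f a μ).trans ?_
    -- A null `f` has `f a > 0` while `f = 0` almost everywhere, so its half space is null.
    by_cases hf0 : mk μ f = 0
    · have hnull : μ.real {x | f a ≤ f x} = 0 := by
        rw [measureReal_eq_zero_iff, measure_eq_zero_iff_ae_notMem]
        filter_upwards [ae_eq_zero_of_mk_eq_zero hf0] with x hx
        simpa [hx, hf0] using hf
      rw [hnull]
      exact (sub_pos.2 (stdNormalCdf_lt_one _)).le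
    · rw [measureReal_halfspace hμ hf0]
      refine sub_le_sub_left (stdNormalCdf_mono ?_) _
      exact (le_div_iff₀ (norm_pos_iff.2 hf0)).2 hf.le
  refine ge_of_tendsto' (x := atTop) (f := fun n : ℕ => 1 - stdNormalCdf n) ?_ hbound
  simpa using (tendsto_stdNormalCdf_atTop.comp tendsto_natCast_atTop_atTop).const_sub 1

theorem setOf_tukeyDepth_eq_zero (hμ : ∫ x, x ∂μ = 0) :
    {a : B | tukeyDepth a μ = 0} = (Set.range (toBanach μ))ᶜ := by
  ext a
  refine ⟨?_, tukeyDepth_eq_zero_of_notMem_range hμ⟩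
  rintro ha ⟨h, rfl⟩
  exact (tukeyDepth_toBanach_pos hμ h).ne' ha

/-! ### Finite-dimensional subspaces -/

/-- Otherwise the range of `S` would be a quotient of the space of restrictions to `V`, which is
finite-dimensional. -/
theorem exists_dual_eq_zero_on (hinf : ¬ FiniteDimensional ℝ (CameronMartinSpace μ))
    (V : Submodule ℝ B) [FiniteDimensional ℝ V] :
    ∃ f : StrongDual ℝ B, (∀ x ∈ V, f x = 0) ∧ mk μ f ≠ 0 := by
  by_contra! hV
  let r : StrongDual ℝ B →ₗ[ℝ] (V →ₗ[ℝ] ℝ) :=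
    { toFun := fun f => f.toLinearMap ∘ₗ V.subtype
      map_add' := fun f g => by ext; simp
      map_smul' := fun c f => by ext; simp }
  have hle : LinearMap.ker r ≤ LinearMap.ker (mk μ) := fun f hf =>
    hV f fun x hx => LinearMap.congr_fun hf ⟨x, hx⟩
  have hfin : FiniteDimensional ℝ (StrongDual ℝ B ⧸ LinearMap.ker r) :=
    Module.Finite.equiv r.quotKerEquivRange.symm
  have : FiniteDimensional ℝ (RangeS μ) := by
    refine Module.Finite.of_surjective ((LinearMap.ker r).liftQ (mk μ) hle) fun x => ?_
    obtain ⟨f, rfl⟩ := mk_surjective μ x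
    exact ⟨Submodule.Quotient.mk f, rfl⟩
  exact hinf finiteDimensional_of_rangeS

theorem measure_submodule_eq_zero (hμ : ∫ x, x ∂μ = 0)
    (hinf : ¬ FiniteDimensional ℝ (CameronMartinSpace μ))
    (V : Submodule ℝ B) [FiniteDimensional ℝ V] : μ V = 0 := by
  obtain ⟨f, hfV, hf⟩ := exists_dual_eq_zero_on hinf V
  exact measure_mono_null hfV (measure_dual_eq_zero hμ hf)

end CameronMartin

/-! ### Random vectors and the span of independent ones -/

section Span

variable {B : Type*} [NormedAddCommGroup B] [NormedSpace ℝ B] [SecondCountableTopology B]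
  [MeasurableSpace B] [BorelSpace B]

/-- Bounding the coefficients by `N` gives the projection of a closed set along a compact ball,
hence a closed set. -/
theorem measurableSet_mem_span_insert_range {ι : Type*} [Fintype ι] (b : B) :
    MeasurableSet {p : B × (ι → B) | p.1 ∈ Submodule.span ℝ (insert b (Set.range p.2))} := by
  have heq : {p : B × (ι → B) | p.1 ∈ Submodule.span ℝ (insert b (Set.range p.2))} =
      ⋃ N : ℕ, Prod.snd '' {q : Metric.closedBall (0 : ℝ × (ι → ℝ)) N × (B × (ι → B)) |
        q.2.1 = q.1.1.1 • b + ∑ i, q.1.1.2 i • q.2.2 i} := by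
    ext ⟨x, y⟩
    simp only [Set.mem_ofPred_eq, Submodule.mem_span_insert,
      Submodule.mem_span_range_iff_exists_fun, Set.mem_iUnion, Set.mem_image]
    constructor
    · rintro ⟨c, _, ⟨w, rfl⟩, hx⟩
      obtain ⟨N, hN⟩ := exists_nat_ge ‖(c, w)‖
      exact ⟨N, ⟨⟨(c, w), mem_closedBall_zero_iff.2 hN⟩, (x, y)⟩, hx, rfl⟩
    · rintro ⟨N, ⟨⟨⟨c, w⟩, hcw⟩, ⟨x', y'⟩⟩, hx, hxy⟩
      obtain ⟨rfl, rfl⟩ := Prod.mk.inj hxy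
      exact ⟨c, _, ⟨w, rfl⟩, hx⟩
  rw [heq]
  refine .iUnion fun N => IsClosed.measurableSet ?_
  have : CompactSpace (Metric.closedBall (0 : ℝ × (ι → ℝ)) N) :=
    isCompact_iff_compactSpace.1 (isCompact_closedBall _ _)
  exact isClosedMap_snd_of_compactSpace _ (isClosed_eq (by fun_prop) (by fun_prop))

/-- By Fubini, for each fixed value of `Y` the span is finite-dimensional and so null for the law of
`X`. -/
theorem ae_notMem_span_of_indepFun {μ : Measure B}
    (hnull : ∀ V : Submodule ℝ B, FiniteDimensional ℝ V → μ V = 0)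
    {Ω : Type*} [MeasurableSpace Ω] {P : Measure Ω} [IsProbabilityMeasure P]
    {ι : Type*} [Fintype ι] {X : Ω → B} {Y : Ω → ι → B} (hX : Measurable X) (hY : Measurable Y)
    (hlaw : P.map X = μ) (hind : IndepFun X Y P) (b : B) :
    ∀ᵐ ω ∂P, X ω ∉ Submodule.span ℝ (insert b (Set.range (Y ω))) := by
  have hmeas := measurableSet_mem_span_insert_range (ι := ι) b
  have h0 : P.map (fun ω => (X ω, Y ω))
      {p | p.1 ∈ Submodule.span ℝ (insert b (Set.range p.2))} = 0 := by
    rw [(indepFun_iff_map_prod_eq_prod_map_map hX.aemeasurable hY.aemeasurable).1 hind, hlaw]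
    have : IsProbabilityMeasure μ := hlaw ▸ Measure.isProbabilityMeasure_map hX.aemeasurable
    have : IsProbabilityMeasure (P.map Y) := Measure.isProbabilityMeasure_map hY.aemeasurable
    rw [Measure.prod_apply_symm hmeas]
    refine (lintegral_congr fun y => ?_).trans lintegral_zero
    have : FiniteDimensional ℝ (Submodule.span ℝ (insert b (Set.range y))) :=
      FiniteDimensional.span_of_finite ℝ ((Set.finite_range y).insert b)
    exact hnull _ this
  rw [Measure.map_apply (hX.prodMk hY) hmeas] at h0
  exact measure_eq_zero_iff_ae_notMem.1 h0

omit [SecondCountableTopology B] [MeasurableSpace B] [BorelSpace B] in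
-- In a convex combination equal to `b` some weight is nonzero, and the equation can be solved for
-- that point.
theorem notMem_convexHull_of_notMem_span {b : B} {n : ℕ} {x : ℕ → B}
    (hx : ∀ j < n, x j ∉ Submodule.span ℝ
      (insert b (Set.range fun i : (Finset.range n).erase j => x i))) :
    b ∉ convexHull ℝ (x '' (Finset.range n : Set ℕ)) := by
  classical
  intro hb
  -- The weights sit on points rather than indices, so coinciding sample points are merged and the
  -- remaining ones have index different from `j`.
  rw [← Finset.coe_image, Finset.mem_convexHull'] at hb
  obtain ⟨w, -, hw1, hwb⟩ := hb
  obtain ⟨y, hy, hwy⟩ : ∃ y ∈ (Finset.range n).image x, w y ≠ 0 := by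
    by_contra! h0
    rw [Finset.sum_eq_zero h0] at hw1
    exact zero_ne_one hw1
  obtain ⟨j, hj, rfl⟩ := Finset.mem_image.1 hy
  refine hx j (Finset.mem_range.1 hj) ((Submodule.smul_mem_iff _ hwy).1 ?_)
  rw [← Finset.add_sum_erase _ _ hy] at hwb
  rw [eq_sub_of_add_eq hwb]
  refine Submodule.sub_mem _ (Submodule.subset_span (Set.mem_insert _ _))
    (Submodule.sum_mem _ fun z hz => Submodule.smul_mem _ _ (Submodule.subset_span (.inr ?_)))
  obtain ⟨hne, hz⟩ := Finset.mem_erase.1 hz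
  obtain ⟨i, hi, rfl⟩ := Finset.mem_image.1 hz
  exact ⟨⟨i, Finset.mem_erase.2 ⟨fun h => hne (h ▸ rfl), hi⟩⟩, rfl⟩

omit [SecondCountableTopology B] in
theorem tukeyDepth_empiricalMeasure_eq_zero {Ω : Type*} {X : ℕ → Ω → B} {n : ℕ} {ω : Ω} {b : B}
    (hb : b ∉ convexHull ℝ ((fun j => X j ω) '' (Finset.range n : Set ℕ))) :
    tukeyDepth b (empiricalMeasure X n ω) = 0 := by
  refine le_antisymm ?_ (tukeyDepth_nonneg _ _)
  have hfin : ((fun j => X j ω) '' (Finset.range n : Set ℕ)).Finite :=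
    (Finset.range n).finite_toSet.image _
  obtain ⟨f, u, hu, hfb⟩ := geometric_hahn_banach_closed_point (convex_convexHull ℝ _)
    (hfin.isClosed_convexHull ℝ) hb
  refine (tukeyDepth_le f _ _).trans_eq ?_
  have hmeas : MeasurableSet {x | f b ≤ f x} := measurableSet_le (by fun_prop) (by fun_prop)
  -- Every Dirac mass vanishes on the half space, so the factor is irrelevant, even for `n = 0`
  -- where it is infinite.
  rw [empiricalMeasure, measureReal_def, Measure.smul_apply, Measure.finsetSum_apply,
    Finset.sum_eq_zero, smul_zero, ENNReal.toReal_zero]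
  intro j hj
  rw [Measure.dirac_apply' _ hmeas, Set.indicator_of_notMem]
  exact not_le.2 ((hu _ (subset_convexHull ℝ _ (Set.mem_image_of_mem _ hj))).trans hfb)

end Span

/-! ### Almost sure vanishing of the empirical depth -/

namespace CameronMartin

variable {B : Type*} [NormedAddCommGroup B] [NormedSpace ℝ B] [CompleteSpace B]
  [SecondCountableTopology B] [MeasurableSpace B] [BorelSpace B]
  {μ : Measure B} [IsGaussian μ]

theorem ae_tukeyDepth_empiricalMeasure_eq_zero (hμ : ∫ x, x ∂μ = 0)
    (hinf : ¬ FiniteDimensional ℝ (CameronMartinSpace μ))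
    {Ω : Type*} [MeasurableSpace Ω] {P : Measure Ω} [IsProbabilityMeasure P] {X : ℕ → Ω → B}
    (hX : ∀ j, Measurable (X j)) (hlaw : ∀ j, P.map (X j) = μ) (hind : iIndepFun X P) (b : B) :
    ∀ᵐ ω ∂P, ∀ n, tukeyDepth b (empiricalMeasure X n ω) = 0 := by
  have hspan : ∀ᵐ ω ∂P, ∀ n j, X j ω ∉ Submodule.span ℝ
      (insert b (Set.range fun i : (Finset.range n).erase j => X i ω)) := by
    refine ae_all_iff.2 fun n => ae_all_iff.2 fun j => ?_
    refine ae_notMem_span_of_indepFun (ι := (Finset.range n).erase j) (Y := fun ω i => X i ω)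
      (fun V _ => measure_submodule_eq_zero hμ hinf V) (hX j)
      (measurable_pi_lambda _ fun i => hX i) (hlaw j) ?_ b
    -- Erasing `j` makes the two index sets disjoint, whether or not `j < n`.
    have h := hind.indepFun_finset {j} ((Finset.range n).erase j) (by simp) hX
    have hj : Measurable fun y : ({j} : Finset ℕ) → B => y ⟨j, Finset.mem_singleton_self j⟩ :=
      measurable_pi_apply _
    exact h.comp hj measurable_id
  filter_upwards [hspan] with ω hω n
  exact tukeyDepth_empiricalMeasure_eq_zero
    (notMem_convexHull_of_notMem_span (x := fun j => X j ω) fun j _ => hω n j)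

end CameronMartin

theorem proposition2 {B : Type*} [NormedAddCommGroup B] [NormedSpace ℝ B] [CompleteSpace B]
    [SecondCountableTopology B] [MeasurableSpace B] [BorelSpace B]
    (μ : Measure B) [IsGaussian μ] (hcentered : ∫ x, x ∂μ = 0) :
    -- the depth on `H_μ`, for `μ` not the point mass at the origin
    (μ ≠ Measure.dirac 0 → ∀ h : CameronMartinSpace μ,
      tukeyDepth (CameronMartinSpace.toBanach μ h) μ = 1 - stdNormalCdf ‖h‖) ∧
    -- the depth off `H_μ`
    (∀ a : B, a ∉ Set.range (CameronMartinSpace.toBanach μ) → tukeyDepth a μ = 0) ∧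
    -- the zero-one law for the set of points of depth zero
    MeasurableSet {a : B | tukeyDepth a μ = 0} ∧
    (FiniteDimensional ℝ (CameronMartinSpace μ) → μ {a : B | tukeyDepth a μ = 0} = 0) ∧
    (¬ FiniteDimensional ℝ (CameronMartinSpace μ) → μ {a : B | tukeyDepth a μ = 0} = 1) ∧
    -- the empirical depth and the failure of consistency
    (¬ FiniteDimensional ℝ (CameronMartinSpace μ) →
      ∀ (Ω : Type*) [MeasurableSpace Ω] (P : Measure Ω) [IsProbabilityMeasure P]
        (X : ℕ → Ω → B), (∀ j, Measurable (X j)) → (∀ j, P.map (X j) = μ) → iIndepFun X P →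
        ∀ h : CameronMartinSpace μ,
          (∀ᵐ ω ∂P, ∀ n : ℕ, 1 ≤ n →
            tukeyDepth (CameronMartinSpace.toBanach μ h) (empiricalMeasure X n ω) = 0) ∧
          0 < tukeyDepth (CameronMartinSpace.toBanach μ h) μ ∧
          (∀ᵐ ω ∂P, ¬ Tendsto
            (fun n : ℕ =>
              tukeyDepth (CameronMartinSpace.toBanach μ h) (empiricalMeasure X n ω))
            atTop (𝓝 (tukeyDepth (CameronMartinSpace.toBanach μ h) μ)))) := by
  have hset := CameronMartin.setOf_tukeyDepth_eq_zero hcentered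
  have hmeas := CameronMartin.measurableSet_range_toBanach (μ := μ)
  refine ⟨fun hd h => ?_, fun a ha => ?_, ?_, fun hfin => ?_, fun hinf => ?_, ?_⟩
  · exact (CameronMartin.tukeyDepth_toBanach_le hcentered hd h).antisymm
      (CameronMartin.le_tukeyDepth_toBanach hcentered h)
  · exact CameronMartin.tukeyDepth_eq_zero_of_notMem_range hcentered ha
  · rw [hset]
    exact hmeas.compl
  · rw [hset]
    exact CameronMartin.ae_mem_range_toBanach
  · rw [hset, prob_compl_eq_one_iff hmeas]
    exact CameronMartin.measure_range_toBanach_eq_zero hcentered hinf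
  · intro hinf Ω _ P _ X hX hlaw hind h
    have hpos := CameronMartin.tukeyDepth_toBanach_pos hcentered h
    have hzero := CameronMartin.ae_tukeyDepth_empiricalMeasure_eq_zero hcentered hinf hX hlaw hind
      (CameronMartinSpace.toBanach μ h)
    refine ⟨hzero.mono fun ω hω n _ => hω n, hpos, hzero.mono fun ω hω hlim => ?_⟩
    simp only [hω] at hlim
    exact hpos.ne (tendsto_nhds_unique tendsto_const_nhds hlim)
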